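/- Let $p$ be a prime and let $G$ be a finite $p$-soluble group whose order is divisible by $p$ (every chief factor of $G$ is a $p$-group or a $p'$-group). Let $P$ be a Sylow $p$-subgroup of $G$, and let $N$ be a normal subgroup of $G$ such that $G/N$ is $p$-supersoluble. Here a finite group is called $p$-supersoluble if each of its chief factors either has order $p$ or has order not divisible by $p$. A subgroup $H$ of $G$ is said to satisfy the $\Pi$-property in $G$ if, for every chief factor $L/K$ of $G$, every prime divisor of the index $|G/K : N_{G/K}(HK/K\cap L/K)|$ divides $|HK/K\cap L/K|$. Let $\Phi(P)$ be the Frattini subgroup of $P$, and let $d$ be the smallest number of generators of $P$, i.e. $p^d=|P/\Phi(P)|$. Denote by $\mathcal{M}_d(P)$ any set $\{P_1,\dots,P_d\}$ of exactly $d$ maximal subgroups of $P$ with $\bigcap_{i=1}^d P_i=\Phi(P)$; such a set is in general not unique. Then $G$ is $p$-supersoluble if and only if there is some $\mathcal{M}_d(P)$ such that $P_i\cap N$ satisfies the $\Pi$-property in $G$ for every $P_i\in\mathcal{M}_d(P)$. Moreover, for each fixed choice of $\mathcal{M}_d(P)$, $G$ is $p$-supersoluble if and only if $P_i\cap N$ satisfies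 the $\Pi$-property in $G$ for every $P_i$ in it. -/

import Mathlib

/-- `n` is a `π`-number: all prime divisors of `n` belong to `π`. -/
def IsPiNumber (π : Set ℕ) (n : ℕ) : Prop :=
  ∀ q : ℕ, q.Prime → q ∣ n → q ∈ π

/-- `π(H)`: the set of all primes dividing the order of `H`. -/
def primesOf (H : Type*) [Group H] : Set ℕ :=
  {q : ℕ | q.Prime ∧ q ∣ Nat.card H}

/-- The image `H K / K` of a subgroup `H` in the quotient `G / K`. -/
def quotImage {G : Type*} [Group G] (H K : Subgroup G) [K.Normal] : Subgroup (G ⧸ K) :=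
  H.map (QuotientGroup.mk' K)

/-- `L / K` is a chief factor of `G`: `K < L` are normal subgroups of `G`, and no normal subgroup
of `G` lies strictly between them. -/
def IsChiefFactor {G : Type*} [Group G] (L K : Subgroup G) : Prop :=
  K.Normal ∧ L.Normal ∧ K < L ∧
    ∀ M : Subgroup G, M.Normal → K ≤ M → M ≤ L → M = K ∨ M = L

/-- `G` is `p`-soluble: every chief factor of `G` is a `p`-group or a `p'`-group. -/
def IsPSoluble (p : ℕ) (G : Type*) [Group G] : Prop :=
  ∀ (L K : Subgroup G) [K.Normal], IsChiefFactor L K →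
    IsPGroup p (quotImage L K) ∨ ¬ p ∣ Nat.card (quotImage L K)

/-- `G` is `p`-supersoluble: every chief factor of `G` has order `p` or is a `p'`-group. -/
def IsPSupersoluble (p : ℕ) (G : Type*) [Group G] : Prop :=
  ∀ (L K : Subgroup G) [K.Normal], IsChiefFactor L K →
    Nat.card (quotImage L K) = p ∨ ¬ p ∣ Nat.card (quotImage L K)

/-- The subgroup `H` satisfies the `Π`-property in `G`: for every chief factor `L / K` of `G`, the
index in `G / K` of the normalizer of `HK/K ∩ L/K` is a `π(HK/K ∩ L/K)`-number. -/
def SatisfiesPi {G : Type*} [Group G] (H : Subgroup G) : Prop :=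
  ∀ (L K : Subgroup G) [K.Normal], IsChiefFactor L K →
    IsPiNumber (primesOf (quotImage H K ⊓ quotImage L K : Subgroup (G ⧸ K)))
      (Subgroup.normalizer
        ((quotImage H K ⊓ quotImage L K : Subgroup (G ⧸ K)) : Set (G ⧸ K))).index

/-- For a finite `p`-group `P` with `|P / Φ(P)| = p ^ d`: the set `𝓜` is an `M_d(P)`, i.e. it
consists of exactly `d` maximal subgroups of `P`, with intersection `Φ(P)`. -/
def IsMd (p : ℕ) {P : Type*} [Group P] (𝓜 : Set (Subgroup P)) : Prop :=
  (∀ M ∈ 𝓜, IsCoatom M) ∧ sInf 𝓜 = frattini P ∧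
    Nat.card (P ⧸ frattini P) = p ^ 𝓜.ncard

/-!
Let `D` be the residual of `G` for the class of abelian groups of exponent dividing `p - 1`. It
contains every `p`-subgroup and centralizes every normal subgroup of order `p`. For a finite
`p`-soluble group, `p`-supersolubility is equivalent to `p`-nilpotency of `D`
(`IsPSupersoluble.hasPNilpotentResidual`, `HasPNilpotentResidual.isPSupersoluble`): the action of
`G` on a `p`-chief factor centralized by `D` is diagonalizable over `𝔽_p`, hence scalar.

If `G` is `p`-supersoluble, then every `p`-subgroup has the `Π`-property, since it meets each chief
factor of order `p` in a normal subgroup. Families `𝓜_d(P)` exist: a minimal family of maximal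
subgroups with intersection `Φ(P)` is one.

Conversely, `D` is shown to be `p`-nilpotent modulo each normal subgroup `R ≤ N` of `G` with
`P ∩ R ≤ Φ(P)`, by downward induction on `R`; the case `R = 1` is what is wanted. If
`N ∩ D'R = R`, then in `G / R` the group `D` embeds in the product of its abelianization and of its
`p`-nilpotent image in `G / N`. Otherwise take a chief factor `T / R` with `T ≤ N ∩ D'R`.
* If it is a `p'`-group, or a `p`-group with `P ∩ T ≤ Φ(P)`, the induction hypothesis applies to
  `T`, and `p`-nilpotency is carried from `T` down to `R`, in the second case by the Frattini
  argument for complements (`HasPNilpotentResidual.of_nongenerating`).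
* Otherwise some member `P_i` of `𝓜_d(P)` does not contain `P ∩ T`. The `Π`-property of `P_i ∩ N` at
  `T / R` makes `(P_i ∩ N)R ∩ T` normal, hence equal to `R`, so `|T / R| = p` and `T / R` meets the
  image of `P_i ≥ P'` trivially. The transfer from `D` to the abelianization of the Sylow subgroup
  then shows that `T / R` meets the derived group of `D` trivially
  (`inf_commutator_abelianResidual_eq_bot`), contrary to `T ≤ D'R`.
-/

open scoped commutatorElement

/-- The residual of the class of abelian groups of exponent dividing `p - 1`: the verbal subgroup
generated by all commutators and all `(p - 1)`-th powers. -/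
def abelianResidual (p : ℕ) (G : Type*) [Group G] : Subgroup G :=
  Subgroup.closure ({x | ∃ a b : G, ⁅a, b⁆ = x} ∪ {x | ∃ a : G, a ^ (p - 1) = x})

/-- The image of `abelianResidual p G` in `G / R` is `p`-nilpotent. This is phrased inside `G`: some
normal subgroup `Q ≥ R` has index `|Q : R|` prime to `p`, and every element of the residual
has a `p`-power power in `Q`. -/
def HasPNilpotentResidual (p : ℕ) {G : Type*} [Group G] (R : Subgroup G) : Prop :=
  ∃ Q : Subgroup G, Q.Normal ∧ R ≤ Q ∧ ¬ p ∣ R.relIndex Q ∧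
    ∀ x ∈ abelianResidual p G, ∃ k : ℕ, x ^ p ^ k ∈ Q

/-! ### Elements of the residual -/

section abelianResidual

variable {p : ℕ} {G : Type*} [Group G]

theorem commutatorElement_mem_abelianResidual (a b : G) : ⁅a, b⁆ ∈ abelianResidual p G :=
  Subgroup.subset_closure (Or.inl ⟨a, b, rfl⟩)

theorem pow_mem_abelianResidual (a : G) : a ^ (p - 1) ∈ abelianResidual p G :=
  Subgroup.subset_closure (Or.inr ⟨a, rfl⟩)

theorem abelianResidual_le {H : Subgroup G} (hc : ∀ a b : G, ⁅a, b⁆ ∈ H)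
    (hp : ∀ a : G, a ^ (p - 1) ∈ H) : abelianResidual p G ≤ H := by
  rw [abelianResidual, Subgroup.closure_le]
  rintro x (⟨a, b, rfl⟩ | ⟨a, rfl⟩)
  exacts [hc a b, hp a]

instance abelianResidual_normal : (abelianResidual p G).Normal := by
  refine ⟨fun n hn g => ?_⟩
  have h : g * n * g⁻¹ = ⁅g, n⁆ * n := by group
  rw [h]
  exact mul_mem (commutatorElement_mem_abelianResidual g n) hn

theorem map_abelianResidual {H : Type*} [Group H] (f : G →* H) (hf : Function.Surjective f) :
    (abelianResidual p G).map f = abelianResidual p H := by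
  refine le_antisymm ?_ ?_
  · rw [Subgroup.map_le_iff_le_comap]
    refine abelianResidual_le (fun a b => ?_) (fun a => ?_)
    · rw [Subgroup.mem_comap, map_commutatorElement]
      exact commutatorElement_mem_abelianResidual _ _
    · rw [Subgroup.mem_comap, map_pow]
      exact pow_mem_abelianResidual _
  · refine abelianResidual_le (fun a b => ?_) (fun a => ?_)
    · obtain ⟨a, rfl⟩ := hf a
      obtain ⟨b, rfl⟩ := hf b
      exact ⟨⁅a, b⁆, commutatorElement_mem_abelianResidual a b, map_commutatorElement f a b⟩
    · obtain ⟨a, rfl⟩ := hf a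
      exact ⟨a ^ (p - 1), pow_mem_abelianResidual a, map_pow f a _⟩

/-- Elements of `p`-power order are `(p - 1)`-th powers. -/
theorem IsPGroup.le_abelianResidual (hp : p.Prime) {P : Subgroup G} (hP : IsPGroup p P) :
    P ≤ abelianResidual p G := by
  intro x hx
  have hc : p.Coprime (p - 1) := by
    rw [Nat.coprime_self_sub_right hp.one_le]
    exact Nat.coprime_one_right p
  have h := (hP.powEquiv hc).apply_symm_apply ⟨x, hx⟩
  rw [IsPGroup.powEquiv_apply] at h
  have h' := congrArg Subtype.val h
  exact Subgroup.subset_closure (Or.inr ⟨_, h'⟩)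

/-- The automorphism group of a group of order `p` is abelian of exponent dividing `p - 1`. -/
theorem abelianResidual_le_centralizer (hp : p.Prime) (T : Subgroup G) [T.Normal]
    (hT : Nat.card T = p) : abelianResidual p G ≤ Subgroup.centralizer (T : Set G) := by
  have := Fact.mk hp
  have : IsCyclic T := isCyclic_of_prime_card hT
  have e : MulAut T ≃* (ZMod p)ˣ := hT ▸ IsCyclic.mulAutMulEquiv T
  have hker : abelianResidual p G ≤
      (e.toMonoidHom.comp (MulAut.conjNormal : G →* MulAut T)).ker := by
    refine abelianResidual_le (fun a b => ?_) (fun a => ?_)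
    · rw [MonoidHom.mem_ker, map_commutatorElement]
      exact commutatorElement_eq_one_iff_mul_comm.2 (mul_comm _ _)
    · rw [MonoidHom.mem_ker, map_pow]
      exact ZMod.units_pow_card_sub_one_eq_one p _
  intro x hx
  rw [Subgroup.mem_centralizer_iff]
  intro t ht
  have h : e (MulAut.conjNormal x) = 1 := hker hx
  rw [MulEquiv.map_eq_one_iff] at h
  have h' := congrArg Subtype.val (DFunLike.congr_fun h (⟨t, ht⟩ : T))
  rw [MulAut.conjNormal_apply] at h'
  exact (mul_inv_eq_iff_eq_mul.1 h').symm

end abelianResidual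

/-! ### Passage between normal subgroups and quotients -/

section HasPNilpotentResidual

variable {p : ℕ} {G : Type*} [Group G]

theorem hasPNilpotentResidual_top (hp : p.Prime) :
    HasPNilpotentResidual p (⊤ : Subgroup G) :=
  ⟨⊤, inferInstance, le_rfl, by simpa using hp.one_lt.ne', fun _ _ => ⟨0, trivial⟩⟩

/-- Passing down a factor `T / R` of order prime to `p`. -/
theorem HasPNilpotentResidual.of_not_dvd (hp : p.Prime) {R T : Subgroup G} (hRT : R ≤ T)
    (h : ¬ p ∣ R.relIndex T) (hT : HasPNilpotentResidual p T) : HasPNilpotentResidual p R := by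
  obtain ⟨Q, hQ, hTQ, hpQ, hx⟩ := hT
  refine ⟨Q, hQ, hRT.trans hTQ, ?_, hx⟩
  rw [← Subgroup.relIndex_mul_relIndex R T Q hRT hTQ, hp.dvd_mul]
  tauto

theorem HasPNilpotentResidual.map {R T : Subgroup G} [R.Normal] (hRT : R ≤ T)
    (hT : HasPNilpotentResidual p T) :
    HasPNilpotentResidual p (T.map (QuotientGroup.mk' R)) := by
  obtain ⟨Q, hQ, hTQ, hpQ, hx⟩ := hT
  have hs := QuotientGroup.mk'_surjective R
  refine ⟨Q.map (QuotientGroup.mk' R), hQ.map _ hs, Subgroup.map_mono hTQ, ?_, ?_⟩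
  · rwa [Subgroup.relIndex_map_map, QuotientGroup.ker_mk', sup_eq_left.2 hRT,
      sup_eq_left.2 (hRT.trans hTQ)]
  · rw [← map_abelianResidual _ hs]
    rintro _ ⟨x, hxD, rfl⟩
    obtain ⟨k, hk⟩ := hx x hxD
    exact ⟨k, by rw [← map_pow]; exact Subgroup.mem_map_of_mem _ hk⟩

theorem HasPNilpotentResidual.of_quotient {R : Subgroup G} [R.Normal]
    (h : HasPNilpotentResidual p (⊥ : Subgroup (G ⧸ R))) : HasPNilpotentResidual p R := by
  obtain ⟨Q, hQ, -, hpQ, hx⟩ := h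
  have hs := QuotientGroup.mk'_surjective R
  have hR : (⊥ : Subgroup (G ⧸ R)).comap (QuotientGroup.mk' R) = R := by
    rw [MonoidHom.comap_bot, QuotientGroup.ker_mk']
  refine ⟨Q.comap (QuotientGroup.mk' R), hQ.comap _, ?_, ?_, ?_⟩
  · conv_lhs => rw [← hR]
    exact Subgroup.comap_mono bot_le
  · conv in R.relIndex => rw [← hR]
    rwa [Subgroup.relIndex_comap, Subgroup.map_comap_eq_self_of_surjective hs]
  · intro x hxD
    obtain ⟨k, hk⟩ := hx (QuotientGroup.mk' R x)
      (map_abelianResidual (p := p) _ hs ▸ Subgroup.mem_map_of_mem _ hxD)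
    exact ⟨k, by rwa [Subgroup.mem_comap, map_pow]⟩

end HasPNilpotentResidual

/-! ### `p`-nilpotency from a subdirect embedding -/

section

variable {p : ℕ} {G : Type*} [Group G]

theorem Subgroup.mem_of_pow_mem_of_pow_mem {H : Subgroup G} {x : G} {m n : ℕ}
    (hmn : m.Coprime n) (hm : x ^ m ∈ H) (hn : x ^ n ∈ H) : x ∈ H := by
  have h : (m : ℤ) * m.gcdA n + n * m.gcdB n = 1 := by
    rw [← Nat.gcd_eq_gcd_ab, hmn.gcd_eq_one, Nat.cast_one]
  rw [← zpow_one x, ← h, zpow_add, zpow_mul, zpow_mul, zpow_natCast, zpow_natCast]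
  exact mul_mem (zpow_mem hm _) (zpow_mem hn _)

theorem Subgroup.pow_relIndex_mem_of_mem {N K : Subgroup G} [N.Normal] {x : G} (hx : x ∈ K) :
    x ^ N.relIndex K ∈ N :=
  (N.subgroupOf K).pow_index_mem ⟨x, hx⟩

/-- If `N` meets the derived group of the residual `D` trivially, then `D` embeds in the product of
`D / (D ⊓ N)` and the abelian group `D / ⁅D, D⁆`, so `D` is `p`-nilpotent as soon as `D / (D ⊓ N)`
is. -/
theorem HasPNilpotentResidual.of_inf_commutator_eq_bot [Finite G] (hp : p.Prime)
    {N : Subgroup G} [N.Normal] (hN : HasPNilpotentResidual p N)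
    (h : N ⊓ ⁅abelianResidual p G, abelianResidual p G⁆ = ⊥) :
    HasPNilpotentResidual p (⊥ : Subgroup G) := by
  obtain ⟨K, hK, hNK, hpK, hx⟩ := hN
  set D := abelianResidual p G
  -- The elements of `K ⊓ D` whose image in the abelian group `D / ⁅D, D⁆` has order prime to `p`.
  let Q : Subgroup G :=
    { carrier := {x | x ∈ K ∧ x ∈ D ∧ ∃ m, ¬ p ∣ m ∧ x ^ m ∈ ⁅D, D⁆}
      one_mem' := ⟨one_mem _, one_mem _, 1, by simpa using hp.one_lt.ne', by simp⟩
      mul_mem' := by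
        rintro x y ⟨hxK, hxD, m, hm, hxm⟩ ⟨hyK, hyD, n, hn, hyn⟩
        refine ⟨mul_mem hxK hyK, mul_mem hxD hyD, m * n, by rw [hp.dvd_mul]; tauto, ?_⟩
        have hc : Commute (x : G ⧸ ⁅D, D⁆) (y : G ⧸ ⁅D, D⁆) := by
          rw [commute_iff_eq, ← QuotientGroup.mk_mul, ← QuotientGroup.mk_mul, QuotientGroup.eq]
          have : (x * y)⁻¹ * (y * x) = ⁅y⁻¹, x⁻¹⁆ := by
            rw [commutatorElement_def]; group
          rw [this]
          exact Subgroup.commutator_mem_commutator (inv_mem hyD) (inv_mem hxD)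
        rw [← QuotientGroup.eq_one_iff] at hxm hyn ⊢
        rw [QuotientGroup.mk_pow] at hxm hyn ⊢
        rw [QuotientGroup.mk_mul, hc.mul_pow, pow_mul, hxm, mul_comm m n, pow_mul, hyn]
        simp
      inv_mem' := by
        rintro x ⟨hxK, hxD, m, hm, hxm⟩
        exact ⟨inv_mem hxK, inv_mem hxD, m, hm, by rw [inv_pow]; exact inv_mem hxm⟩ }
  refine ⟨Q, ⟨?_⟩, bot_le, ?_, ?_⟩
  · rintro x ⟨hxK, hxD, m, hm, hxm⟩ g
    refine ⟨hK.conj_mem x hxK g, abelianResidual_normal.conj_mem x hxD g, m, hm, ?_⟩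
    rw [conj_pow]
    exact Subgroup.Normal.conj_mem inferInstance _ hxm g
  · rw [Subgroup.relIndex_bot_left]
    intro hdvd
    have := Fact.mk hp
    obtain ⟨⟨x, hxQ⟩, hord'⟩ := exists_prime_orderOf_dvd_card' p hdvd
    have hord : orderOf x = p := by rw [← hord', ← Subgroup.orderOf_coe]
    obtain ⟨hxK, hxD, m, hm, hxm⟩ := hxQ
    have hxN : x ∈ N := by
      refine Subgroup.mem_of_pow_mem_of_pow_mem ((hp.coprime_iff_not_dvd).2 hpK) ?_
        (Subgroup.pow_relIndex_mem_of_mem hxK)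
      rw [← hord, pow_orderOf_eq_one]
      exact one_mem _
    have hm1 : x ^ m = 1 := Subgroup.mem_bot.1 (h ▸ ⟨pow_mem hxN m, hxm⟩)
    exact hm (hord ▸ orderOf_dvd_of_pow_eq_one hm1)
  · intro x hxD
    obtain ⟨k, hk⟩ := hx x hxD
    obtain ⟨j, m, hm, hj⟩ := Nat.exists_eq_pow_mul_and_not_dvd (orderOf_pos x).ne' p hp.ne_one
    refine ⟨k + j, ?_, pow_mem hxD _, m, hm, ?_⟩
    · rw [pow_add, pow_mul]
      exact pow_mem hk _
    · rw [← pow_mul, pow_add, mul_assoc, ← hj, mul_comm, pow_mul, pow_orderOf_eq_one, one_pow]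
      exact one_mem _

/-! ### Complements of abelian normal Hall subgroups -/

section SchurZassenhaus

open MulAction Subgroup
open scoped Pointwise

/-- A complement of `H` is a transversal of `H`, and stabilizes the point of `H.QuotientDiff` which
that transversal represents. -/
theorem Subgroup.IsComplement'.eq_stabilizer [Finite G] {H : Subgroup G} [IsMulCommutative H]
    [H.Normal] (hH : (Nat.card H).Coprime H.index) {Q : Subgroup G} (hQ : IsComplement' H Q) :
    ∃ α : H.QuotientDiff, stabilizer G α = Q := by
  let S : H.LeftTransversal := ⟨(Q : Set G), hQ.symm⟩
  let α : H.QuotientDiff := Quotient.mk'' S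
  refine ⟨α, ?_⟩
  have hle : Q ≤ stabilizer G α := by
    intro q hq
    rw [mem_stabilizer_iff]
    refine congrArg (Quotient.mk'' : H.LeftTransversal → H.QuotientDiff) (Subtype.ext ?_)
    change MulOpposite.op q⁻¹ • (Q : Set G) = Q
    exact op_smul_coe_set (inv_mem hq)
  refine (Subgroup.eq_of_le_of_card_ge hle ?_).symm
  have h1 := (isComplement'_stabilizer_of_coprime (α := α) hH).card_mul_card
  have h2 := hQ.card_mul_card
  exact (Nat.eq_of_mul_eq_mul_left Nat.card_pos (h1.trans h2.symm)).le

/-- Complements of an abelian normal Hall subgroup `H` are conjugate: each is the stabilizer of a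
point for the action on `H.QuotientDiff`, on which `H` is transitive. -/
theorem Subgroup.IsComplement'.exists_map_conj_eq [Finite G] {H : Subgroup G} [IsMulCommutative H]
    [H.Normal] (hH : (Nat.card H).Coprime H.index) {Q R : Subgroup G} (hQ : IsComplement' H Q)
    (hR : IsComplement' H R) : ∃ h ∈ H, Q.map (MulAut.conj h).toMonoidHom = R := by
  obtain ⟨α, rfl⟩ := hQ.eq_stabilizer hH
  obtain ⟨β, rfl⟩ := hR.eq_stabilizer hH
  obtain ⟨h, rfl⟩ := exists_smul_eq hH α β
  exact ⟨h, h.2, (stabilizer_smul_eq_stabilizer_map_conj (h : G) α).symm⟩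

/-- The Frattini argument for the complements of `T` in a normal subgroup `K`, where `T` is an
abelian normal Hall subgroup of `K`. -/
theorem Subgroup.exists_complement_sup_normalizer_eq_top [Finite G] {T K : Subgroup G} [T.Normal]
    [K.Normal] [IsMulCommutative T] (hTK : T ≤ K) (h : (Nat.card T).Coprime (T.relIndex K)) :
    ∃ Q ≤ K, Nat.card Q = T.relIndex K ∧ T ⊔ normalizer (Q : Set G) = ⊤ := by
  have hcard : Nat.card (T.subgroupOf K) = Nat.card T :=
    Nat.card_congr (Subgroup.subgroupOfEquivOfLe hTK).toEquiv
  have hcop : (Nat.card (T.subgroupOf K)).Coprime (T.subgroupOf K).index := by rwa [hcard]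
  obtain ⟨Q, hQ⟩ := exists_right_complement'_of_coprime hcop
  have hQc : Nat.card Q = T.relIndex K := by
    have h1 := hQ.card_mul_card
    rw [← (T.subgroupOf K).card_mul_index] at h1
    exact Nat.eq_of_mul_eq_mul_left Nat.card_pos h1
  refine ⟨Q.map K.subtype, map_subtype_le Q, ?_, ?_⟩
  · rw [card_map_of_injective K.subtype_injective, hQc]
  · rw [eq_top_iff]
    rintro g -
    let φ : K ≃* K := MulAut.conjNormal g
    have hφ : IsComplement' (T.subgroupOf K) (Q.map φ.toMonoidHom) := by
      refine isComplement'_of_coprime ?_ ?_ <;>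
        rw [card_map_of_injective (f := φ.toMonoidHom) φ.injective]
      exacts [hQ.card_mul_card, hQc ▸ hcop]
    obtain ⟨t, ht, hconj⟩ := hQ.exists_map_conj_eq hcop hφ
    have hg : g = (t : G) * ((t : G)⁻¹ * g) := by group
    rw [hg]
    refine mul_mem_sup (mem_subgroupOf.1 ht) ?_
    rw [mem_normalizer_iff_map_conj_eq]
    have h1 := congrArg (fun X =>
      Subgroup.map (MulAut.conj (t : G)⁻¹).toMonoidHom (X.map K.subtype)) hconj
    simp only [Subgroup.map_map] at h1 ⊢
    have h2 : ((MulAut.conj (t : G)⁻¹).toMonoidHom.comp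
        (K.subtype.comp (MulAut.conj t).toMonoidHom)) = K.subtype := by
      ext x; simp; group
    have h3 : ((MulAut.conj (t : G)⁻¹).toMonoidHom.comp
        (K.subtype.comp φ.toMonoidHom)) =
        (MulAut.conj ((t : G)⁻¹ * g)).toMonoidHom.comp K.subtype := by
      ext x; simp [φ, mul_assoc]
    rw [h2, h3] at h1
    exact h1.symm

end SchurZassenhaus

/-- A normal abelian `p`-subgroup consisting of non-generators can be factored out. -/
theorem HasPNilpotentResidual.of_nongenerating [Finite G] (hp : p.Prime) {T : Subgroup G}
    [T.Normal] [IsMulCommutative T] (hTp : IsPGroup p T)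
    (hT : HasPNilpotentResidual p T) (hΦ : ∀ X : Subgroup G, T ⊔ X = ⊤ → X = ⊤) :
    HasPNilpotentResidual p (⊥ : Subgroup G) := by
  obtain ⟨K, hK, hTK, hpK, hx⟩ := hT
  have := Fact.mk hp
  obtain ⟨n, hn⟩ := IsPGroup.iff_card.1 hTp
  have hcop : (Nat.card T).Coprime (T.relIndex K) := by
    rw [hn]
    exact Nat.Coprime.pow_left n ((hp.coprime_iff_not_dvd).2 hpK)
  obtain ⟨Q, hQK, hQ, hN⟩ := Subgroup.exists_complement_sup_normalizer_eq_top hTK hcop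
  have hQn : Q.Normal := Subgroup.normalizer_eq_top_iff.1 (hΦ _ hN)
  refine ⟨Q, hQn, bot_le, by rwa [Subgroup.relIndex_bot_left, hQ], fun x hxD => ?_⟩
  obtain ⟨k, hk⟩ := hx x hxD
  have hrel : Q.relIndex K = p ^ n := by
    have h1 := Subgroup.relIndex_mul_relIndex ⊥ Q K bot_le hQK
    have h2 := Subgroup.relIndex_mul_relIndex ⊥ T K bot_le hTK
    rw [Subgroup.relIndex_bot_left] at h1 h2
    rw [← h2, hQ, hn, mul_comm] at h1
    refine Nat.eq_of_mul_eq_mul_right (Nat.pos_of_ne_zero fun h0 => ?_) h1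
    exact hpK (h0 ▸ dvd_zero p)
  refine ⟨k + n, ?_⟩
  rw [pow_add, pow_mul, ← hrel]
  exact Subgroup.pow_relIndex_mem_of_mem hk

/-! ### Transfer and normal subgroups of order `p` -/

section Transfer

/-- A central element of the derived group has its `|E : P|`-th power in `⁅P, P⁆`: that power is
its image under the transfer to the abelianization of `P`. -/
theorem Subgroup.pow_index_mem_commutator {E : Type*} [Group E] [Finite E] (P : Subgroup E) {t : E}
    (ht : t ∈ Subgroup.center E) (htc : t ∈ _root_.commutator E) : t ^ P.index ∈ ⁅P, P⁆ := by
  have key : ∀ (k : ℕ) (g₀ : E), g₀⁻¹ * t ^ k * g₀ ∈ P → g₀⁻¹ * t ^ k * g₀ = t ^ k := by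
    intro k g₀ _
    rw [mul_assoc, ← Subgroup.mem_center_iff.1 (pow_mem ht k) g₀, inv_mul_cancel_left]
  have h := MonoidHom.transfer_eq_pow (Abelianization.of (G := P)) t key
  have h1 := Abelianization.commutator_subset_ker
    (MonoidHom.transfer (Abelianization.of (G := P))) htc
  rw [MonoidHom.mem_ker, h, ← MonoidHom.mem_ker, Abelianization.ker_of] at h1
  rw [← Subgroup.map_subtype_commutator]
  exact ⟨_, h1, rfl⟩

/-- The residual centralizes `T`, so the transfer into the abelianization of a Sylow `p`-subgroup
restricts on `T` to a power map with exponent prime to `p`. -/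
theorem inf_commutator_abelianResidual_eq_bot [Finite G] (hp : p.Prime) {T P : Subgroup G}
    [T.Normal] (hT : Nat.card T = p) (hP : IsPGroup p P) (hPi : ¬ p ∣ P.index)
    (h : T ⊓ ⁅P, P⁆ = ⊥) :
    T ⊓ ⁅abelianResidual p G, abelianResidual p G⁆ = ⊥ := by
  have hPD := hP.le_abelianResidual hp
  have hDC := abelianResidual_le_centralizer hp T hT
  set D := abelianResidual p G
  rw [eq_bot_iff]
  rintro t ⟨htT, htD⟩
  rw [← Subgroup.map_subtype_commutator] at htD
  obtain ⟨s, hs, rfl⟩ := htD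
  have hsc : s ∈ Subgroup.center D := by
    rw [Subgroup.mem_center_iff]
    exact fun g => Subtype.ext (Subgroup.mem_centralizer_iff.1 (hDC g.2) _ htT).symm
  have h1 := Subgroup.mem_map_of_mem D.subtype
    (Subgroup.pow_index_mem_commutator (P.subgroupOf D) hsc hs)
  rw [Subgroup.map_commutator, Subgroup.subgroupOf_map_subtype, inf_eq_left.2 hPD, map_pow] at h1
  refine Subgroup.mem_of_pow_mem_of_pow_mem (m := p) (n := P.relIndex D) ?_ ?_ ?_
  · exact (hp.coprime_iff_not_dvd).2 fun hd =>
      hPi (hd.trans (Subgroup.relIndex_dvd_index_of_le hPD))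
  · rw [Subgroup.mem_bot, ← hT]
    exact congrArg Subtype.val (pow_card_eq_one' (x := (⟨_, htT⟩ : T)))
  · rw [← h]
    exact ⟨pow_mem htT _, h1⟩

end Transfer

/-- The derived group of the residual `D` lies in every supplement `X` of a normal subgroup `T` of
order `p`: modulo `T`, which is central in `D`, elements of `D` come from `X`. -/
theorem commutator_abelianResidual_le_of_sup_eq_top (hp : p.Prime) {T X : Subgroup G} [T.Normal]
    (hT : Nat.card T = p) (hX : T ⊔ X = ⊤) :
    ⁅abelianResidual p G, abelianResidual p G⁆ ≤ X := by
  have hDC := abelianResidual_le_centralizer hp T hT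
  have := Fact.mk hp
  have hTp : IsPGroup p T := IsPGroup.of_card (n := 1) (by rw [hT, pow_one])
  have hTC := (hTp.le_abelianResidual hp).trans hDC
  rw [Subgroup.commutator_le]
  intro a ha b hb
  obtain ⟨t, ht, x, hx, rfl⟩ := Subgroup.mem_sup_of_normal_left.1 (hX.ge (Subgroup.mem_top a))
  obtain ⟨s, hs, y, hy, rfl⟩ := Subgroup.mem_sup_of_normal_left.1 (hX.ge (Subgroup.mem_top b))
  have hc : ∀ {u g : G}, u ∈ T → g ∈ Subgroup.centralizer (T : Set G) → Commute u g :=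
    fun hu hg => Subgroup.mem_centralizer_iff.1 hg _ hu
  have hxC : x ∈ Subgroup.centralizer (T : Set G) := by
    simpa using mul_mem (inv_mem (hTC ht)) (hDC ha)
  have hyC : y ∈ Subgroup.centralizer (T : Set G) := by
    simpa using mul_mem (inv_mem (hTC hs)) (hDC hb)
  have h1 : ⁅t * x, s * y⁆ = ⁅x, y⁆ := by
    have e1 : ⁅t * x, s * y⁆ = s * ⁅t * x, y⁆ * s⁻¹ := by
      have := (hc hs (hDC ha)).eq
      simp only [commutatorElement_def, mul_inv_rev, ← mul_assoc] at this ⊢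
      rw [this]
    have e2 : ⁅t * x, y⁆ = t * ⁅x, y⁆ * t⁻¹ := by
      have := (hc ht hyC).inv_left.eq
      simp only [commutatorElement_def, mul_inv_rev, mul_assoc] at this ⊢
      rw [(hc ht hyC).inv_inv.eq]
    have hxy : ⁅x, y⁆ ∈ Subgroup.centralizer (T : Set G) := by
      rw [commutatorElement_def]
      exact mul_mem (mul_mem (mul_mem hxC hyC) (inv_mem hxC)) (inv_mem hyC)
    rw [e1, e2, (hc ht hxy).mul_inv_cancel, (hc hs hxy).mul_inv_cancel]
  rw [h1, commutatorElement_def]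
  exact mul_mem (mul_mem (mul_mem hx hy) (inv_mem hx)) (inv_mem hy)

end

/-! ### Chief factors and minimal normal subgroups -/

section ChiefFactor

variable {p : ℕ} {G : Type*} [Group G]

theorem card_quotImage (L K : Subgroup G) [K.Normal] :
    Nat.card (quotImage L K) = K.relIndex L := by
  rw [quotImage, ← Subgroup.relIndex_ker, QuotientGroup.ker_mk']

theorem quotImage_normal (L K : Subgroup G) [K.Normal] [hL : L.Normal] :
    (quotImage L K).Normal :=
  hL.map _ (QuotientGroup.mk'_surjective K)

theorem exists_isChiefFactor [Finite G] {R M : Subgroup G} [hR : R.Normal] [hM : M.Normal]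
    (h : R < M) : ∃ T ≤ M, IsChiefFactor T R := by
  obtain ⟨T, ⟨hTn, hRT, hTM⟩, hmin⟩ :=
    (Set.toFinite {T : Subgroup G | T.Normal ∧ R < T ∧ T ≤ M}).exists_minimal ⟨M, hM, h, le_rfl⟩
  refine ⟨T, hTM, hR, hTn, hRT, fun X hX hRX hXT => ?_⟩
  rcases hRX.eq_or_lt with h | h
  · exact Or.inl h.symm
  · exact Or.inr (le_antisymm hXT (hmin ⟨hX, h, hXT.trans hTM⟩ hXT))

theorem IsChiefFactor.quotImage_ne_bot {L K : Subgroup G} [K.Normal] (h : IsChiefFactor L K) :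
    quotImage L K ≠ ⊥ := by
  rw [quotImage, Ne, Subgroup.map_eq_bot_iff, QuotientGroup.ker_mk']
  exact h.2.2.1.not_ge

theorem IsChiefFactor.eq_bot_or_eq {L K : Subgroup G} [K.Normal] (h : IsChiefFactor L K)
    {X : Subgroup (G ⧸ K)} (hX : X.Normal) (hXL : X ≤ quotImage L K) :
    X = ⊥ ∨ X = quotImage L K := by
  have hs := QuotientGroup.mk'_surjective K
  have hmap := Subgroup.map_comap_eq_self_of_surjective hs X
  have hKX : K ≤ X.comap (QuotientGroup.mk' K) := by
    conv_lhs => rw [← QuotientGroup.ker_mk' K]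
    exact Subgroup.ker_le_comap _ _
  have hXL' : X.comap (QuotientGroup.mk' K) ≤ L := by
    refine (Subgroup.comap_mono hXL).trans ?_
    rw [quotImage, Subgroup.comap_map_eq, QuotientGroup.ker_mk']
    exact sup_le le_rfl h.2.2.1.le
  rcases h.2.2.2 (X.comap (QuotientGroup.mk' K)) (hX.comap _) hKX hXL' with h1 | h1
  · left
    rw [← hmap, h1, Subgroup.map_eq_bot_iff, QuotientGroup.ker_mk']
  · right
    rw [← hmap, h1, quotImage]

end ChiefFactor

/-! ### The residual of a `p`-supersoluble group -/

section Necessity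

variable {p : ℕ} {G : Type*} [Group G]

/-- The residual of a `p`-supersoluble group is `p`-nilpotent. A minimal normal subgroup of order
`p` either lies in the Frattini subgroup or has a complement, and the complement contains the
derived group of the residual. -/
theorem IsPSupersoluble.hasPNilpotentResidual [Finite G] (hp : p.Prime)
    (h : IsPSupersoluble p G) (R : Subgroup G) (hR : R.Normal) : HasPNilpotentResidual p R := by
  induction R using WellFoundedGT.induction with
  | ind R ih =>
    rcases (le_top : R ≤ ⊤).eq_or_lt with rfl | hlt
    · exact hasPNilpotentResidual_top hp
    obtain ⟨T, -, hT⟩ := exists_isChiefFactor hlt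
    have hTn : T.Normal := hT.2.1
    have hTR := ih T hT.2.2.1 hTn
    rcases h T R hT with hc | hc
    · have := Fact.mk hp
      have hbar : HasPNilpotentResidual p (quotImage T R) := hTR.map hT.2.2.1.le
      have hn := quotImage_normal T R
      have hcyc : IsCyclic (quotImage T R) := isCyclic_of_prime_card hc
      refine HasPNilpotentResidual.of_quotient ?_
      by_cases hΦ : ∀ X : Subgroup (G ⧸ R), quotImage T R ⊔ X = ⊤ → X = ⊤
      · exact hbar.of_nongenerating hp (IsPGroup.of_card (n := 1) (by rw [hc, pow_one])) hΦ
      · push Not at hΦ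
        obtain ⟨X, hX, hXt⟩ := hΦ
        refine hbar.of_inf_commutator_eq_bot hp (le_bot_iff.1 ?_)
        refine (inf_le_inf_left _ (commutator_abelianResidual_le_of_sup_eq_top hp hc hX)).trans ?_
        have := Fact.mk (hc.symm ▸ hp : (Nat.card (quotImage T R)).Prime)
        rcases (X.subgroupOf (quotImage T R)).eq_bot_or_eq_top_of_prime_card with h1 | h1
        · exact (Subgroup.subgroupOf_eq_bot.1 h1).symm.le_bot
        · rw [Subgroup.subgroupOf_eq_top] at h1
          exact absurd (by rwa [sup_eq_right.2 h1] at hX) hXt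
    · rw [card_quotImage] at hc
      exact hTR.of_not_dvd hp hT.2.2.1.le hc

end Necessity

/-! ### Groups with `p`-nilpotent residual -/

section Sufficiency

open Polynomial in
/-- An endomorphism `f` with `f^[p] = f` over `𝔽_p` has an eigenvector, because
`X ^ p - X` splits over `𝔽_p`. -/
theorem Module.End.exists_eigenvector_of_iterate_eq {p : ℕ} [Fact p.Prime] {V : Type*}
    [AddCommGroup V] [Module (ZMod p) V] [Nontrivial V] (f : Module.End (ZMod p) V)
    (hf : ∀ v, f^[p] v = f v) : ∃ a : ZMod p, ∃ v ≠ 0, f v = a • v := by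
  by_contra! hno
  have hinj : ∀ s : Multiset (ZMod p),
      Function.Injective (aeval f (s.map fun a => X - C a).prod) := by
    intro s
    induction s using Multiset.induction with
    | empty => exact fun a b hab => by simpa using hab
    | cons a s ih =>
      rw [Multiset.map_cons, Multiset.prod_cons, map_mul, Module.End.mul_eq_comp,
        LinearMap.coe_comp]
      refine Function.Injective.comp ?_ ih
      rw [injective_iff_map_eq_zero]
      intro v hv
      by_contra hv0
      refine hno a v hv0 ?_
      simpa [sub_eq_zero] using hv
  have hp := (Fact.out : p.Prime)
  have hroots : (X ^ p - X : (ZMod p)[X]).roots = Finset.univ.val := by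
    have h := FiniteField.roots_X_pow_card_sub_X (ZMod p)
    rwa [ZMod.card] at h
  have hprod := prod_multiset_X_sub_C_of_monic_of_roots_card_eq
    (p := (X ^ p - X : (ZMod p)[X]))
    (monic_X_pow_sub (by rw [degree_X]; exact_mod_cast hp.one_lt))
    (by rw [hroots, FiniteField.X_pow_card_sub_X_natDegree_eq _ hp.one_lt]; simp [ZMod.card])
  have h0 := hinj (X ^ p - X : (ZMod p)[X]).roots
  rw [hprod] at h0
  obtain ⟨v, hv⟩ := exists_ne (0 : V)
  refine hv (h0 ?_)
  simp [Module.End.pow_apply, hf]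

/-- `Module.End.exists_eigenvector_of_iterate_eq` for elementary abelian groups written
multiplicatively. -/
theorem MonoidHom.exists_map_eq_pow {p : ℕ} [Fact p.Prime] {L : Type*} [CommGroup L] [Nontrivial L]
    (hL : ∀ x : L, x ^ p = 1) (φ : Monoid.End L) (hφ : φ ^ p = φ) :
    ∃ k : ℕ, ∃ v : L, v ≠ 1 ∧ φ v = v ^ k := by
  have hL' : ∀ x : Additive L, p • x = 0 := fun x => hL x.toMul
  have : Module (ZMod p) (Additive L) := AddCommGroup.zmodModule hL'
  let f : Module.End (ZMod p) (Additive L) := (MonoidHom.toAdditive φ).toZModLinearMap p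
  have hf : ∀ x, f^[p] x = f x := by
    intro x
    change Additive.ofMul (φ^[p] x.toMul) = _
    rw [← Monoid.End.coe_pow, hφ]
    rfl
  obtain ⟨a, v, hv, h⟩ := Module.End.exists_eigenvector_of_iterate_eq f hf
  refine ⟨a.val, v.toMul, hv, ?_⟩
  rw [← ZMod.natCast_zmod_val a, Nat.cast_smul_eq_nsmul] at h
  exact h

variable {p : ℕ} {G : Type*} [Group G]

/-- A minimal normal `p`-subgroup is centralized by a `p`-nilpotent residual: the normal
`p'`-subgroup `Q` centralizes it by coprimality, and the remaining `p`-group has fixed points. -/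
theorem HasPNilpotentResidual.le_centralizer [Finite G] (hp : p.Prime)
    (h : HasPNilpotentResidual p (⊥ : Subgroup G)) {L : Subgroup G} [hLn : L.Normal]
    (hL : IsPGroup p L) (hne : L ≠ ⊥)
    (hmin : ∀ X : Subgroup G, X.Normal → X ≤ L → X = ⊥ ∨ X = L) :
    L ≤ Subgroup.centralizer (abelianResidual p G : Set G) := by
  have := Fact.mk hp
  obtain ⟨Q, hQ, -, hpQ, hx⟩ := h
  rw [Subgroup.relIndex_bot_left] at hpQ
  obtain ⟨n, hn⟩ := IsPGroup.iff_card.1 hL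
  have hdisj : Disjoint L Q := by
    refine Subgroup.disjoint_of_coprime_natCard ?_
    rw [hn]
    exact Nat.Coprime.pow_left n ((hp.coprime_iff_not_dvd).2 hpQ)
  let A : Subgroup (MulAut L) := (abelianResidual p G).map MulAut.conjNormal
  have hA : IsPGroup p A := by
    rw [isPGroup_iff_pow_pow_eq_one]
    rintro ⟨_, x, hxD, rfl⟩
    obtain ⟨k, hk⟩ := hx x hxD
    refine ⟨k, Subtype.ext ?_⟩
    rw [Subgroup.coe_pow, ← map_pow]
    ext l
    have := Subgroup.commute_of_normal_of_disjoint L Q hLn hQ hdisj l _ l.2 hk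
    rw [MulAut.conjNormal_apply, ← this.eq]
    simp
  have hpL : p ∣ Nat.card L := hL.card_eq_or_dvd.resolve_left fun h =>
    hne (Subgroup.eq_bot_of_card_eq L h)
  obtain ⟨b, hb, hb1⟩ := hA.exists_fixed_point_of_prime_dvd_card_of_fixed_point L hpL
    (a := (1 : L)) (fun g => map_one (g : MulAut L))
  have hbD : (b : G) ∈ Subgroup.centralizer (abelianResidual p G : Set G) := by
    rw [Subgroup.mem_centralizer_iff]
    intro d hd
    have h1 : MulAut.conjNormal d b = b := hb ⟨_, d, hd, rfl⟩
    have h2 := congrArg Subtype.val h1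
    rw [MulAut.conjNormal_apply] at h2
    exact mul_inv_eq_iff_eq_mul.1 h2
  rcases hmin (L ⊓ Subgroup.centralizer (abelianResidual p G : Set G)) inferInstance inf_le_left
    with h1 | h1
  · have : (b : G) ∈ L ⊓ Subgroup.centralizer (abelianResidual p G : Set G) := ⟨b.2, hbD⟩
    rw [h1, Subgroup.mem_bot] at this
    exact absurd (Subtype.ext this.symm) hb1
  · exact inf_eq_left.1 h1

/-- Every element of `G` acts on a minimal normal `p`-subgroup `L` through commuting automorphisms
of exponent dividing `p - 1`, hence as a power map, so every subgroup of `L` is normal in `G`. -/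
theorem HasPNilpotentResidual.card_minimal_normal [Finite G] (hp : p.Prime)
    (h : HasPNilpotentResidual p (⊥ : Subgroup G)) {L : Subgroup G} [hLn : L.Normal]
    (hL : IsPGroup p L) (hne : L ≠ ⊥)
    (hmin : ∀ X : Subgroup G, X.Normal → X ≤ L → X = ⊥ ∨ X = L) : Nat.card L = p := by
  have := Fact.mk hp
  have hLC := h.le_centralizer hp hL hne hmin
  have hLD := hL.le_abelianResidual hp
  have hcD : ∀ {d l : G}, d ∈ abelianResidual p G → l ∈ L → d * l = l * d :=
    fun hd hl => Subgroup.mem_centralizer_iff.1 (hLC hl) _ hd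
  have hpL : p ∣ Nat.card L := hL.card_eq_or_dvd.resolve_left fun h =>
    hne (Subgroup.eq_bot_of_card_eq L h)
  obtain ⟨x, hx⟩ := exists_prime_orderOf_dvd_card' p hpL
  have hx1 : x ≠ 1 := by
    rintro rfl
    exact hp.one_lt.ne (orderOf_one.symm.trans hx)
  let : CommGroup L :=
    { (inferInstance : Group L) with
      mul_comm := fun a b => Subtype.ext (hcD (hLD a.2) b.2) }
  have hnt : Nontrivial L := ⟨x, 1, hx1⟩
  -- `L` is the only nontrivial subgroup of `L` invariant under conjugation.
  have hmin' : ∀ Y : Subgroup L, (∀ g : G, ∀ y ∈ Y, MulAut.conjNormal g y ∈ Y) →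
      ∀ y ∈ Y, y ≠ 1 → Y = ⊤ := by
    intro Y hY y hy hy1
    have hYn : (Y.map L.subtype).Normal := by
      refine ⟨?_⟩
      rintro _ ⟨z, hz, rfl⟩ g
      exact ⟨_, hY g z hz, MulAut.conjNormal_apply g z⟩
    rcases hmin _ hYn (Subgroup.map_subtype_le Y) with h1 | h1
    · rw [Subgroup.map_eq_bot_iff_of_injective _ L.subtype_injective] at h1
      exact absurd (Subgroup.mem_bot.1 (h1 ▸ hy)) hy1
    · rw [eq_top_iff]
      intro z _
      have hz : (z : G) ∈ Y.map L.subtype := h1.ge z.2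
      obtain ⟨w, hw, hwz⟩ := hz
      rwa [← Subtype.ext hwz]
  have hexp : ∀ y : L, y ^ p = 1 := by
    have := hmin' (powMonoidHom p : L →* L).ker (fun g y hy => by
      rw [MonoidHom.mem_ker, powMonoidHom_apply] at hy ⊢
      rw [← map_pow, hy, map_one]) x (by
        rw [MonoidHom.mem_ker, powMonoidHom_apply, ← hx, pow_orderOf_eq_one]) hx1
    exact fun y => (this ▸ Subgroup.mem_top y : y ∈ (powMonoidHom p : L →* L).ker)
  have hpow : ∀ g : G, ∃ k : ℕ, ∀ y : L, MulAut.conjNormal g y = y ^ k := by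
    intro g
    have hD : ∀ d ∈ abelianResidual p G, (MulAut.conjNormal d : MulAut L) = 1 := by
      intro d hd
      ext l
      rw [MulAut.conjNormal_apply, hcD hd l.2]
      simp
    let φ : Monoid.End L := (MulAut.conjNormal g : MulAut L).toMonoidHom
    have hφ : ∀ n : ℕ, φ ^ n = ((MulAut.conjNormal g : MulAut L) ^ n).toMonoidHom := by
      intro n
      induction n with
      | zero => rfl
      | succ n ih => rw [pow_succ, ih, pow_succ]; rfl
    have hφp : φ ^ p = φ := by
      rw [hφ, ← Nat.sub_add_cancel hp.one_le, pow_succ, ← map_pow,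
        hD _ (pow_mem_abelianResidual g), one_mul]
    obtain ⟨k, v, hv, hk⟩ := MonoidHom.exists_map_eq_pow hexp φ hφp
    refine ⟨k, fun y => ?_⟩
    have htop := hmin' (φ.eqLocus (powMonoidHom k : L →* L)) (fun a y hy => by
      have hy' : (MulAut.conjNormal g : MulAut L) y = y ^ k := hy
      change (MulAut.conjNormal g : MulAut L) (MulAut.conjNormal a y) = (MulAut.conjNormal a y) ^ k
      rw [← map_pow, ← hy', ← MulAut.mul_apply, ← MulAut.mul_apply, ← map_mul, ← map_mul]
      have hga : g * a = a * g * ⁅g⁻¹, a⁻¹⁆ := by rw [commutatorElement_def]; group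
      rw [hga, map_mul _ (a * g), hD _ (commutatorElement_mem_abelianResidual _ _), mul_one])
      v hk hv
    exact (htop ▸ Subgroup.mem_top y : y ∈ φ.eqLocus (powMonoidHom k : L →* L))
  have htop := hmin' (Subgroup.zpowers x) (fun g y hy => by
    obtain ⟨k, hk⟩ := hpow g
    rw [hk]
    exact pow_mem hy k) x (Subgroup.mem_zpowers x) hx1
  rw [← Subgroup.card_top, ← htop, Nat.card_zpowers, hx]

theorem HasPNilpotentResidual.quotient_bot [Finite G]
    (h : HasPNilpotentResidual p (⊥ : Subgroup G)) (K : Subgroup G) [K.Normal] :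
    HasPNilpotentResidual p (⊥ : Subgroup (G ⧸ K)) := by
  obtain ⟨Q, hQ, -, hpQ, hx⟩ := h
  rw [Subgroup.relIndex_bot_left] at hpQ
  have hs := QuotientGroup.mk'_surjective K
  refine ⟨Q.map (QuotientGroup.mk' K), hQ.map _ hs, bot_le, ?_, ?_⟩
  · rw [Subgroup.relIndex_bot_left]
    exact fun hd => hpQ (hd.trans (Subgroup.card_map_dvd Q _))
  · rw [← map_abelianResidual _ hs]
    rintro _ ⟨x, hxD, rfl⟩
    obtain ⟨k, hk⟩ := hx x hxD
    exact ⟨k, by rw [← map_pow]; exact Subgroup.mem_map_of_mem _ hk⟩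

theorem HasPNilpotentResidual.isPSupersoluble [Finite G] (hp : p.Prime)
    (h : HasPNilpotentResidual p (⊥ : Subgroup G)) (hG : IsPSoluble p G) :
    IsPSupersoluble p G := by
  intro L K _ hLK
  have hL : L.Normal := hLK.2.1
  have := quotImage_normal L K
  exact (hG L K hLK).imp_left fun hp' => (h.quotient_bot K).card_minimal_normal hp hp'
    hLK.quotImage_ne_bot fun X hX hXL => hLK.eq_bot_or_eq hX hXL

end Sufficiency

/-! ### Maximal subgroups of `p`-groups -/

section MaximalSubgroups

variable {p : ℕ} {P : Type*} [Group P] [Finite P]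

theorem IsPGroup.normal_of_isCoatom (hp : p.Prime) (hP : IsPGroup p P) {M : Subgroup P}
    (hM : IsCoatom M) : M.Normal := by
  have := Fact.mk hp
  have := hP.isNilpotent
  exact Subgroup.NormalizerCondition.normal_of_coatom M Group.normalizerCondition_of_isNilpotent hM

theorem IsPGroup.index_of_isCoatom (hp : p.Prime) (hP : IsPGroup p P) {M : Subgroup P}
    (hM : IsCoatom M) : M.index = p := by
  have := Fact.mk hp
  have hMn := hP.normal_of_isCoatom hp hM
  have hs := QuotientGroup.mk'_surjective M
  have hdvd : p ∣ Nat.card (P ⧸ M) := by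
    refine (hP.to_quotient M).card_eq_or_dvd.resolve_left fun h => ?_
    rw [← Subgroup.index_eq_card, Subgroup.index_eq_one] at h
    exact hM.1 h
  obtain ⟨x, hx⟩ := exists_prime_orderOf_dvd_card' p hdvd
  have hle : M ≤ (Subgroup.zpowers x).comap (QuotientGroup.mk' M) := by
    conv_lhs => rw [← QuotientGroup.ker_mk' M]
    exact Subgroup.ker_le_comap _ _
  have hmap := Subgroup.map_comap_eq_self_of_surjective hs (Subgroup.zpowers x)
  rcases hle.eq_or_lt with h | h
  · rw [← h, QuotientGroup.map_mk'_self] at hmap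
    have h1 := Nat.card_zpowers x
    rw [← hmap, Subgroup.card_bot, hx] at h1
    exact absurd h1.symm hp.one_lt.ne'
  · rw [hM.2 _ h, Subgroup.map_top_of_surjective _ hs] at hmap
    rw [Subgroup.index_eq_card, ← hx, ← Nat.card_zpowers, ← hmap, Subgroup.card_top]

theorem IsPGroup.commutator_le_of_isCoatom (hp : p.Prime) (hP : IsPGroup p P) {M : Subgroup P}
    (hM : IsCoatom M) : _root_.commutator P ≤ M := by
  have := Fact.mk hp
  have hMn := hP.normal_of_isCoatom hp hM
  have hcyc : IsCyclic (P ⧸ M) :=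
    isCyclic_of_prime_card (p := p) (by rw [← Subgroup.index_eq_card, hP.index_of_isCoatom hp hM])
  rw [← Subgroup.Normal.quotient_commutative_iff_commutator_le]
  infer_instance

/-- A minimal set of maximal subgroups intersecting in the Frattini subgroup: each member cuts
the index of the intersection by a factor `p`, because otherwise it could be omitted. -/
theorem IsPGroup.exists_isMd (hp : p.Prime) (hP : IsPGroup p P) :
    ∃ 𝓜 : Set (Subgroup P), IsMd p 𝓜 := by
  obtain ⟨𝓜, ⟨hc, hinf⟩, hmin⟩ := (Set.toFinite
    {𝓜 : Set (Subgroup P) | (∀ M ∈ 𝓜, IsCoatom M) ∧ sInf 𝓜 = frattini P}).exists_minimal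
    ⟨{M | IsCoatom M}, fun _ h => h, by rw [sInf_eq_iInf]; rfl⟩
  refine ⟨𝓜, hc, hinf, ?_⟩
  have key : ∀ 𝓢 ⊆ 𝓜, (sInf 𝓢).index = p ^ 𝓢.ncard := by
    intro 𝓢 h𝓢
    induction 𝓢, Set.toFinite 𝓢 using Set.Finite.induction_on with
    | empty => simp
    | @insert M 𝓢 hM _ ih =>
      rw [Set.insert_subset_iff] at h𝓢
      have hMn := hP.normal_of_isCoatom hp (hc M h𝓢.1)
      have hrel : M.relIndex (sInf 𝓢) = p := by
        refine ((Nat.dvd_prime hp).1 ?_).resolve_left fun h1 => ?_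
        · rw [← hP.index_of_isCoatom hp (hc M h𝓢.1)]
          exact Subgroup.relIndex_dvd_index_of_normal M _
        · rw [Subgroup.relIndex_eq_one] at h1
          have hsub : 𝓢 ⊆ 𝓜 \ {M} := fun S hS =>
            ⟨h𝓢.2 hS, fun hSM => hM (Set.mem_singleton_iff.1 hSM ▸ hS)⟩
          have hle : sInf (𝓜 \ {M}) ≤ sInf 𝓜 := by
            refine le_sInf fun S hS => ?_
            by_cases hSM : S = M
            · exact hSM ▸ (sInf_le_sInf hsub).trans h1
            · exact sInf_le ⟨hS, hSM⟩
          have h2 := hmin (y := 𝓜 \ {M}) ⟨fun S hS => hc S hS.1,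
            (le_antisymm hle (sInf_le_sInf Set.sdiff_subset)).trans hinf⟩ Set.sdiff_subset
          exact (h2 h𝓢.1).2 rfl
      rw [sInf_insert, Set.ncard_insert_of_notMem hM, pow_succ', ← ih h𝓢.2,
        ← Subgroup.relIndex_mul_index (inf_le_right : M ⊓ sInf 𝓢 ≤ sInf 𝓢),
        Subgroup.inf_relIndex_right, hrel]
  rw [← Subgroup.index_eq_card, ← hinf, key 𝓜 subset_rfl]

end MaximalSubgroups

/-! ### The `Π`-property of `p`-subgroups -/

section PiProperty

variable {p : ℕ} {G : Type*} [Group G]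

theorem satisfiesPi_of_normal {H : Subgroup G}
    (h : ∀ (L K : Subgroup G) [K.Normal], IsChiefFactor L K →
      (quotImage H K ⊓ quotImage L K).Normal) : SatisfiesPi H := by
  intro L K _ hLK q hq hqd
  rw [Subgroup.normalizer_eq_top_iff.2 (h L K hLK), Subgroup.index_top] at hqd
  exact absurd (Nat.dvd_one.1 hqd) hq.ne_one

theorem IsPSupersoluble.satisfiesPi [Finite G] (hp : p.Prime) (hG : IsPSupersoluble p G)
    {H : Subgroup G} (hH : IsPGroup p H) : SatisfiesPi H := by
  refine satisfiesPi_of_normal fun L K _ hLK => ?_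
  have := Fact.mk hp
  have hL : L.Normal := hLK.2.1
  have hLn := quotImage_normal L K
  rcases hG L K hLK with hc | hc
  · have := Fact.mk (hc.symm ▸ hp : (Nat.card (quotImage L K)).Prime)
    rcases ((quotImage H K).subgroupOf (quotImage L K)).eq_bot_or_eq_top_of_prime_card with h | h
    · rw [(Subgroup.subgroupOf_eq_bot.1 h).eq_bot]
      infer_instance
    · rwa [inf_eq_right.2 (Subgroup.subgroupOf_eq_top.1 h)]
  · obtain ⟨n, hn⟩ := IsPGroup.iff_card.1 (hH.map (QuotientGroup.mk' K))
    have hd : Disjoint (quotImage H K) (quotImage L K) := by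
      refine Subgroup.disjoint_of_coprime_natCard ?_
      rw [quotImage, hn]
      exact Nat.Coprime.pow_left n ((hp.coprime_iff_not_dvd).2 hc)
    rw [hd.eq_bot]
    infer_instance

/-- If `H` has the `Π`-property and is normalized by a subgroup `P` of index prime to `p`, then its
trace on a chief factor which is a `p`-group is normal: the index of the normalizer is both
a `p`-number and prime to `p`. -/
theorem SatisfiesPi.normal_of_le_normalizer [Finite G] (hp : p.Prime) {H P : Subgroup G}
    (hH : SatisfiesPi H) (hP : ¬ p ∣ P.index) (hPH : P ≤ Subgroup.normalizer (H : Set G))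
    {L K : Subgroup G} [K.Normal] (hLK : IsChiefFactor L K) (hL : IsPGroup p (quotImage L K)) :
    (quotImage H K ⊓ quotImage L K).Normal := by
  have := Fact.mk hp
  have hLn : L.Normal := hLK.2.1
  have hqL := quotImage_normal L K
  have hs := QuotientGroup.mk'_surjective K
  have hle : P.map (QuotientGroup.mk' K) ≤
      Subgroup.normalizer ((quotImage H K ⊓ quotImage L K : Subgroup (G ⧸ K)) : Set (G ⧸ K)) := by
    rw [Subgroup.le_normalizer_iff]
    rintro _ ⟨g, hg, rfl⟩ x ⟨⟨h, hh, rfl⟩, hxL⟩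
    refine ⟨⟨g * h * g⁻¹, (Subgroup.mem_normalizer_iff.1 (hPH hg) h).1 hh, by simp⟩,
      hqL.conj_mem _ hxL _⟩
  rw [← Subgroup.normalizer_eq_top_iff, ← Subgroup.index_eq_one]
  by_contra h1
  obtain ⟨q, hq, hqd⟩ := Nat.exists_prime_and_dvd h1
  obtain ⟨-, hqI⟩ := hH L K hLK q hq hqd
  obtain ⟨n, hn⟩ := IsPGroup.iff_card.1
    (hL.to_le (inf_le_right : quotImage H K ⊓ quotImage L K ≤ _))
  rw [hn] at hqI
  obtain rfl := (Nat.prime_dvd_prime_iff_eq hq hp).1 (hq.dvd_of_dvd_pow hqI)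
  exact hP ((hqd.trans (Subgroup.index_dvd_of_le hle)).trans (Subgroup.index_map_dvd P hs))

end PiProperty

/-! ### Induction along chief factors -/

section Descent

variable {p : ℕ} {G : Type*} [Group G]

theorem quotImage_commutator_abelianResidual (R : Subgroup G) [R.Normal] :
    quotImage ⁅abelianResidual p G, abelianResidual p G⁆ R =
      ⁅abelianResidual p (G ⧸ R), abelianResidual p (G ⧸ R)⁆ := by
  rw [quotImage, Subgroup.map_commutator, map_abelianResidual _ (QuotientGroup.mk'_surjective R)]

theorem IsChiefFactor.isMulCommutative [Finite G] (hp : p.Prime) {T R : Subgroup G} [R.Normal]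
    (hT : IsChiefFactor T R) (hTp : IsPGroup p (quotImage T R)) :
    IsMulCommutative (quotImage T R) := by
  have := Fact.mk hp
  have hTn : T.Normal := hT.2.1
  have hn := quotImage_normal T R
  have hnt : Nontrivial (quotImage T R) :=
    (Subgroup.nontrivial_iff_ne_bot _).2 hT.quotImage_ne_bot
  have hcn : ((Subgroup.center (quotImage T R)).map (quotImage T R).subtype).Normal :=
    inferInstance
  have htop : Subgroup.center (quotImage T R) = ⊤ := by
    rcases hT.eq_bot_or_eq hcn (Subgroup.map_subtype_le _) with h | h
    · rw [Subgroup.map_eq_bot_iff_of_injective _ (Subgroup.subtype_injective _)] at h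
      exact absurd h hTp.bot_lt_center.ne'
    · rw [eq_top_iff]
      intro z _
      obtain ⟨w, hw, hwz⟩ := h.ge z.2
      rwa [← Subtype.ext hwz]
  exact ⟨⟨fun a b => Subgroup.mem_center_iff.1 (htop.ge (Subgroup.mem_top b)) a⟩⟩

/-- If `T / R` is a normal `p`-subgroup of `G / R`, then the Sylow `p`-subgroup `P ⊓ T` of `T`
covers `T / R`. -/
theorem Sylow.map_subgroupOf_sup_eq [Finite G] (hp : p.Prime) (P : Sylow p G) {T R : Subgroup G}
    [R.Normal] [T.Normal] (hRT : R ≤ T) (hTp : IsPGroup p (quotImage T R)) :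
    (T.subgroupOf P).map (P : Subgroup G).subtype ⊔ R = T := by
  have := Fact.mk hp
  have hn := quotImage_normal T R
  have hs := QuotientGroup.mk'_surjective R
  have hle := hTp.le_sylow_of_normal (P.mapSurjective hs)
  rw [Sylow.coe_mapSurjective] at hle
  rw [Subgroup.subgroupOf_map_subtype]
  refine le_antisymm (sup_le inf_le_left hRT) fun t ht => ?_
  obtain ⟨x, hx, hxt⟩ := hle (Subgroup.mem_map_of_mem _ ht)
  rw [QuotientGroup.mk'_apply, QuotientGroup.mk'_apply, QuotientGroup.eq] at hxt
  have hxT : x ∈ T := by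
    have := mul_mem ht (inv_mem (hRT hxt))
    simpa using this
  rw [← mul_inv_cancel_left x t]
  exact Subgroup.mul_mem_sup ⟨hxT, hx⟩ hxt

theorem HasPNilpotentResidual.of_le_frattini [Finite G] (hp : p.Prime) (P : Sylow p G)
    {T R : Subgroup G} [R.Normal] (hT : IsChiefFactor T R) (hTp : IsPGroup p (quotImage T R))
    (hΦ : T.subgroupOf P ≤ frattini P) (h : HasPNilpotentResidual p T) :
    HasPNilpotentResidual p R := by
  have hTn : T.Normal := hT.2.1
  have hn := quotImage_normal T R
  have hcomm := hT.isMulCommutative hp hTp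
  have hs := QuotientGroup.mk'_surjective R
  have hcover := P.map_subgroupOf_sup_eq hp hT.2.2.1.le hTp
  have hbar : HasPNilpotentResidual p (quotImage T R) := h.map hT.2.2.1.le
  refine .of_quotient (hbar.of_nongenerating hp hTp fun X hX => ?_)
  let Y := X.comap (QuotientGroup.mk' R)
  have hRY : R ≤ Y := by
    conv_lhs => rw [← QuotientGroup.ker_mk' R]
    exact Subgroup.ker_le_comap _ _
  have hgen : Y.subgroupOf P ⊔ frattini P = ⊤ := by
    rw [eq_top_iff]
    rintro x -
    have hx : QuotientGroup.mk' R x ∈ quotImage T R ⊔ X := hX.ge (Subgroup.mem_top _)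
    obtain ⟨_, ⟨t, ht, rfl⟩, z, hz, hzx⟩ := Subgroup.mem_sup_of_normal_left.1 hx
    obtain ⟨_, ⟨s, hsT, rfl⟩, r, hr, rfl⟩ :=
      Subgroup.mem_sup_of_normal_right.1 (hcover.ge ht)
    have hy : s⁻¹ * x ∈ Y.subgroupOf P := by
      rw [Subgroup.mem_subgroupOf, Subgroup.mem_comap]
      have hr1 : QuotientGroup.mk' R r = 1 := (QuotientGroup.eq_one_iff r).2 hr
      rw [Subgroup.coe_mul, map_mul, ← hzx, map_mul, hr1]
      simpa using hz
    rw [← mul_inv_cancel_left s x, sup_comm]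
    exact Subgroup.mul_mem_sup (hΦ hsT) hy
  have hPY : (P : Subgroup G) ≤ Y := Subgroup.subgroupOf_eq_top.1 (frattini_nongenerating hgen)
  have hTY : T ≤ Y := by
    rw [← hcover]
    exact sup_le ((Subgroup.map_subtype_le _).trans hPY) hRY
  rw [← hX, right_eq_sup]
  exact Subgroup.map_le_iff_le_comap.2 hTY

/-- Let the chief factor `T / R` be a `p`-group, where `M` contains `P ⊓ R` but not `P ⊓ T`. By the
`Π`-property, `T / R` has order `p` and meets the image of `M` trivially. By transfer it is then not
contained in the derived group of the residual of `G / R`. -/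
theorem IsChiefFactor.not_le_commutator_sup [Finite G] (hp : p.Prime) (P : Sylow p G)
    {N : Subgroup G} [N.Normal] {M : Subgroup P} (hM : IsCoatom M)
    (hPi : SatisfiesPi (M.map (P : Subgroup G).subtype ⊓ N))
    {T R : Subgroup G} [R.Normal] (hT : IsChiefFactor T R) (hTp : IsPGroup p (quotImage T R))
    (hTN : T ≤ N) (hRM : R.subgroupOf P ≤ M) (hTM : ¬ T.subgroupOf P ≤ M) :
    ¬ T ≤ ⁅abelianResidual p G, abelianResidual p G⁆ ⊔ R := by
  intro hTD
  have := Fact.mk hp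
  have hTn : T.Normal := hT.2.1
  have hRT : R ≤ T := hT.2.2.1.le
  have hn := quotImage_normal T R
  have hs := QuotientGroup.mk'_surjective R
  have hMn := P.2.normal_of_isCoatom hp hM
  have hcover := P.map_subgroupOf_sup_eq hp hRT hTp
  set M' := M.map (P : Subgroup G).subtype
  have hPN : (P : Subgroup G) ≤ Subgroup.normalizer ((M' ⊓ N : Subgroup G) : Set G) := by
    rw [Subgroup.le_normalizer_iff]
    rintro g hg _ ⟨⟨m, hm, rfl⟩, hmN⟩
    exact ⟨⟨_, hMn.conj_mem m hm ⟨g, hg⟩, rfl⟩, Subgroup.Normal.conj_mem inferInstance _ hmN g⟩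
  have hI := hPi.normal_of_le_normalizer hp P.not_dvd_index hPN hT hTp
  have hbot : quotImage (M' ⊓ N) R ⊓ quotImage T R = ⊥ := by
    refine (hT.eq_bot_or_eq hI inf_le_right).resolve_right fun h => hTM ?_
    intro x hx
    obtain ⟨_, ⟨⟨m, hm, rfl⟩, -⟩, hmx⟩ :=
      (inf_eq_right.1 h) (Subgroup.mem_map_of_mem (QuotientGroup.mk' R) hx)
    have hmx' : m⁻¹ * x ∈ R.subgroupOf P :=
      (QuotientGroup.eq (s := R) (a := (m : G)) (b := (x : G))).1 hmx
    simpa using mul_mem hm (hRM hmx')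
  have hMT : ∀ m ∈ M, (m : G) ∈ T → (m : G) ∈ R := by
    intro m hm hmT
    have : QuotientGroup.mk' R m ∈ quotImage (M' ⊓ N) R ⊓ quotImage T R :=
      ⟨Subgroup.mem_map_of_mem _ ⟨Subgroup.mem_map_of_mem _ hm, hTN hmT⟩,
        Subgroup.mem_map_of_mem _ hmT⟩
    rw [hbot, Subgroup.mem_bot] at this
    exact (QuotientGroup.eq_one_iff _).1 this
  have hcard : Nat.card (quotImage T R) = p := by
    refine ((Nat.dvd_prime hp).1 ?_).resolve_left fun h =>
      hT.quotImage_ne_bot (Subgroup.eq_bot_of_card_eq _ h)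
    rw [card_quotImage, ← hcover, Subgroup.relIndex_sup_right]
    have hle : (M ⊓ T.subgroupOf P).map (P : Subgroup G).subtype ≤ R := by
      rintro _ ⟨m, ⟨hm, hmT⟩, rfl⟩
      exact hMT m hm hmT
    refine (Subgroup.relIndex_dvd_of_le_left _ hle).trans ?_
    rw [Subgroup.relIndex_map_map_of_injective _ _ (Subgroup.subtype_injective _),
      Subgroup.inf_relIndex_right]
    exact (Subgroup.relIndex_dvd_index_of_normal M _).trans (P.2.index_of_isCoatom hp hM).dvd
  -- The image of `P` in `G / R` is a Sylow subgroup whose derived group avoids `T / R`.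
  have htr : quotImage T R ⊓ ⁅(P : Subgroup G).map (QuotientGroup.mk' R),
      (P : Subgroup G).map (QuotientGroup.mk' R)⁆ = ⊥ := by
    rw [← Subgroup.map_commutator, ← Subgroup.map_subtype_commutator, eq_bot_iff]
    rintro _ ⟨⟨t, ht, rfl⟩, ⟨_, ⟨m, hm, rfl⟩, hmt⟩⟩
    have hmT : (m : G) ∈ T := by
      have h1 := inv_mem (hRT (QuotientGroup.eq.1 hmt))
      have h2 := mul_mem ht h1
      simpa using h2
    rw [Subgroup.mem_bot, ← hmt]
    exact (QuotientGroup.eq_one_iff _).2 (hMT m (P.2.commutator_le_of_isCoatom hp hM hm) hmT)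
  have hfinal := inf_commutator_abelianResidual_eq_bot hp hcard (P.2.map (QuotientGroup.mk' R))
    (fun hd => P.not_dvd_index (hd.trans (Subgroup.index_map_dvd _ hs))) htr
  rw [← quotImage_commutator_abelianResidual] at hfinal
  refine hT.quotImage_ne_bot (le_bot_iff.1 (hfinal ▸ le_inf le_rfl ?_))
  refine (Subgroup.map_mono hTD).trans ?_
  rw [Subgroup.map_sup, QuotientGroup.map_mk'_self, sup_bot_eq]
  exact le_rfl

theorem HasPNilpotentResidual.of_inf_commutator_le [Finite G] (hp : p.Prime) {N R : Subgroup G}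
    [N.Normal] [R.Normal] (hRN : R ≤ N) (hN : HasPNilpotentResidual p N)
    (h : N ⊓ (⁅abelianResidual p G, abelianResidual p G⁆ ⊔ R) ≤ R) :
    HasPNilpotentResidual p R := by
  have hbar : HasPNilpotentResidual p (quotImage N R) := hN.map hRN
  have hn := quotImage_normal N R
  refine .of_quotient (hbar.of_inf_commutator_eq_bot hp ?_)
  rw [← quotImage_commutator_abelianResidual, eq_bot_iff]
  rintro _ ⟨⟨x, hx, rfl⟩, ⟨d, hd, hdx⟩⟩
  refine (QuotientGroup.eq_one_iff x).2 (h ⟨hx, ?_⟩)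
  rw [← mul_inv_cancel_left d x]
  exact Subgroup.mul_mem_sup hd (QuotientGroup.eq.1 hdx)

/-- Downward induction over the normal subgroups `R ≤ N` with `P ⊓ R ≤ Φ(P)`. For such
`R`, every maximal subgroup of `P` contains `P ⊓ R`, so that the whole family `𝓜` survives in
`G / R`. -/
theorem hasPNilpotentResidual_of_satisfiesPi [Finite G] (hp : p.Prime) (hG : IsPSoluble p G)
    (P : Sylow p G) {N : Subgroup G} [hNn : N.Normal] (hN : HasPNilpotentResidual p N)
    {𝓜 : Set (Subgroup P)} (h𝓜 : ∀ M ∈ 𝓜, IsCoatom M) (hinf : sInf 𝓜 = frattini P)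
    (hPi : ∀ M ∈ 𝓜, SatisfiesPi (M.map (P : Subgroup G).subtype ⊓ N))
    (R : Subgroup G) (hR : R.Normal) (hRN : R ≤ N) (hRΦ : R.subgroupOf P ≤ frattini P) :
    HasPNilpotentResidual p R := by
  induction R using WellFoundedGT.induction with
  | ind R ih =>
    by_cases hND : N ⊓ (⁅abelianResidual p G, abelianResidual p G⁆ ⊔ R) ≤ R
    · exact hN.of_inf_commutator_le hp hRN hND
    have hlt : R < N ⊓ (⁅abelianResidual p G, abelianResidual p G⁆ ⊔ R) :=
      (le_inf hRN le_sup_right).lt_of_not_ge hND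
    obtain ⟨T, hTle, hT⟩ := exists_isChiefFactor hlt
    have hTN := hTle.trans inf_le_left
    rcases hG T R hT with hTp | hTp
    · by_cases hTΦ : T.subgroupOf P ≤ frattini P
      · exact .of_le_frattini hp P hT hTp hTΦ (ih T hT.2.2.1 hT.2.1 hTN hTΦ)
      · rw [← hinf, le_sInf_iff] at hTΦ
        push Not at hTΦ
        obtain ⟨M, hM, hTM⟩ := hTΦ
        exact absurd (hTle.trans inf_le_right) (hT.not_le_commutator_sup hp P (h𝓜 M hM) (hPi M hM)
          hTp hTN (hRΦ.trans (frattini_le_coatom (h𝓜 M hM))) hTM)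
    · rw [card_quotImage] at hTp
      refine .of_not_dvd hp hT.2.2.1.le hTp (ih T hT.2.2.1 hT.2.1 hTN (le_trans ?_ hRΦ))
      -- `P ⊓ T = P ⊓ R`, since `|T : R|` is prime to `p`.
      intro x hx
      obtain ⟨k, hk⟩ := isPGroup_iff_pow_pow_eq_one.1 P.2 x
      refine Subgroup.mem_of_pow_mem_of_pow_mem
        (((hp.coprime_iff_not_dvd).2 hTp).pow_left k) (hk ▸ one_mem _) ?_
      exact Subgroup.mem_subgroupOf.2 (Subgroup.pow_relIndex_mem_of_mem hx)

end Descent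

theorem theoremA {G : Type*} [Group G] [Finite G] (p : ℕ) (hp : p.Prime)
    (hpG : p ∣ Nat.card G) (hG : IsPSoluble p G) (P : Sylow p G)
    (N : Subgroup G) [N.Normal] (hN : IsPSupersoluble p (G ⧸ N)) :
    (IsPSupersoluble p G ↔
      ∃ 𝓜 : Set (Subgroup (P : Subgroup G)), IsMd p 𝓜 ∧
        ∀ M ∈ 𝓜, SatisfiesPi (M.map (P : Subgroup G).subtype ⊓ N)) ∧
    (∀ 𝓜 : Set (Subgroup (P : Subgroup G)), IsMd p 𝓜 →
      (IsPSupersoluble p G ↔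
        ∀ M ∈ 𝓜, SatisfiesPi (M.map (P : Subgroup G).subtype ⊓ N))) := by
  have hres : HasPNilpotentResidual p N :=
    .of_quotient (hN.hasPNilpotentResidual hp ⊥ inferInstance)
  have hnec : IsPSupersoluble p G → ∀ M : Subgroup (P : Subgroup G),
      SatisfiesPi (M.map (P : Subgroup G).subtype ⊓ N) := fun h M =>
    h.satisfiesPi hp (P.2.to_le (inf_le_left.trans (Subgroup.map_subtype_le M)))
  have hsuff : ∀ 𝓜 : Set (Subgroup (P : Subgroup G)), IsMd p 𝓜 →
      (∀ M ∈ 𝓜, SatisfiesPi (M.map (P : Subgroup G).subtype ⊓ N)) → IsPSupersoluble p G := by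
    intro 𝓜 h𝓜 hPi
    refine (hasPNilpotentResidual_of_satisfiesPi hp hG P hres h𝓜.1 h𝓜.2.1 hPi ⊥ inferInstance
      bot_le ?_).isPSupersoluble hp hG
    rw [Subgroup.bot_subgroupOf]
    exact bot_le
  refine ⟨⟨fun h => ?_, fun ⟨𝓜, h𝓜, hPi⟩ => hsuff 𝓜 h𝓜 hPi⟩,
    fun 𝓜 h𝓜 => ⟨fun h M _ => hnec h M, hsuff 𝓜 h𝓜⟩⟩
  obtain ⟨𝓜, h𝓜⟩ := P.2.exists_isMd hp
  exact ⟨𝓜, h𝓜, fun M _ => hnec h M⟩
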